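/- Let $k<\omega$. Write ${}^{\omega}2$ for the Cantor space and ${}^{\omega>}2$ for the set of finite $0$-$1$ sequences. Let $G_k$ be the abelian group generated by symbols $x_{m,\bar\eta,\nu}$, for $m\le k$, $\bar\eta=\langle\eta_\ell:\ell\le k,\ \ell\ne m\rangle$ with all $\eta_\ell\in{}^{\omega}2$, and $\nu\in{}^{\omega>}2$, together with symbols $y_{\bar\eta,n}$, for $\bar\eta=\langle\eta_\ell:\ell\le k\rangle$ with all $\eta_\ell\in{}^{\omega}2$, and $n<\omega$, freely except for the equations $$n!\,y_{\bar\eta,n+1}=y_{\bar\eta,n}+\sum_{m\le k}x_{m,\bar\eta_m,\eta_m\restriction n}\qquad(\bar\eta\in({}^{\omega}2)^{k+1},\ n<\omega),$$ where $\bar\eta_m=\langle\eta_\ell:\ell\le k,\ \ell\neq m\rangle$ and $\eta_m\restriction n=\langle\eta_m(0),\dots,\eta_m(n-1)\rangle$. For a cardinal $\kappa$, an abelian group is called $\kappa$-free if each of its subgroups of cardinality less than $\kappa$ is a free abelian group. Then: 1. $G_k$ is an $F_\sigma$ group, hence a Borel group: there is an injection $c:G_k\to{}^{\omega}\omega$ such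 that the set $\{c(a):a\in G_k\}$ of (codes of) elements, the graph of addition $\{(c(a),c(b),c(a+b)):a,b\in G_k\}$ and the graph of negation $\{(c(a),c(-a)):a\in G_k\}$ are $F_\sigma$ sets (countable unions of closed sets) in ${}^{\omega}\omega$, $({}^{\omega}\omega)^3$ and $({}^{\omega}\omega)^2$ respectively, and hence Borel. Moreover $c$ can be chosen compatible with the presentation, in the sense that for all fixed $m,\nu$ and $n$ the maps $\bar\eta\mapsto c(x_{m,\bar\eta,\nu})$ and $\bar\eta\mapsto c(y_{\bar\eta,n})$ are continuous on the respective powers of the Cantor space. 2. $G_k$ is $\aleph_{k+1}$-free. 3. If $2^{\aleph_0}\ge\aleph_{k+1}$, then $G_k$ is not free, and it is not even $\aleph_{k+2}$-free. 4. $G_k$ is a free abelian group if and only if $2^{\aleph_0}\le\aleph_k$ (equivalently, $2^{\aleph_0}<\aleph_{k+1}$). -/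

import Mathlib

open Cardinal

/-- A subset of a topological space is `F_σ` if it is a countable union of closed sets. -/
def IsFSigmaSet (X : Type) [TopologicalSpace X] (s : Set X) : Prop :=
  ∃ F : ℕ → Set X, (∀ n, IsClosed (F n)) ∧ s = ⋃ n, F n

/-- A subset of a topological space is Borel. -/
def IsBorelSet (X : Type) [TopologicalSpace X] (s : Set X) : Prop :=
  @MeasurableSet X (borel X) s

/-- `c` identifies the abelian group `A` with a set of points of the Baire space such that the
set of elements, the graph of addition and the graph of negation belong to the class `Γ`. -/
structure IsCodingIn (Γ : ∀ (X : Type) [TopologicalSpace X], Set X → Prop)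
    {A : Type} [AddCommGroup A] (c : A → ℕ → ℕ) : Prop where
  injective : Function.Injective c
  carrier : Γ (ℕ → ℕ) (Set.range c)
  add_graph : Γ ((ℕ → ℕ) × (ℕ → ℕ) × (ℕ → ℕ)) {p | ∃ a b : A, p = (c a, c b, c (a + b))}
  neg_graph : Γ ((ℕ → ℕ) × (ℕ → ℕ)) {p | ∃ a : A, p = (c a, c (-a))}

/-- `A` is `κ`-free: every subgroup of cardinality less than `κ` is a free abelian group. -/
def IsCardFree (κ : Cardinal.{0}) (A : Type) [AddCommGroup A] : Prop :=
  ∀ H : AddSubgroup A, #H < κ → Module.Free ℤ H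

/-- The Cantor space `^ω 2`. -/
abbrev Cantor : Type := ℕ → Bool

/-- The initial segment `η ↾ n = ⟨η(0), …, η(n - 1)⟩`. -/
def Cantor.restrict (η : Cantor) (n : ℕ) : List Bool := List.ofFn fun i : Fin n => η i

/-- The symbols `x_{m, η̄, ν}`, where `m ≤ k`, `η̄ = ⟨η_ℓ : ℓ ≤ k, ℓ ≠ m⟩` is a sequence of members
of the Cantor space and `ν` is a finite binary sequence, and the symbols `y_{η̄, n}`, where
`η̄ = ⟨η_ℓ : ℓ ≤ k⟩` and `n` is a natural number. -/
inductive Gen (k : ℕ) : Type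
  | x (m : Fin (k + 1)) (η : {l : Fin (k + 1) // l ≠ m} → Cantor) (ν : List Bool) : Gen k
  | y (η : Fin (k + 1) → Cantor) (n : ℕ) : Gen k

/-- The sequence `η̄_m = η̄ ↾ {m' ≤ k : m' ≠ m}`. -/
def dropAt {k : ℕ} (η : Fin (k + 1) → Cantor) (m : Fin (k + 1)) :
    {l : Fin (k + 1) // l ≠ m} → Cantor :=
  fun l => η l.1

/-- Left side minus right side of the equation
`n! • y_{η̄, n + 1} = y_{η̄, n} + ∑_{m ≤ k} x_{m, η̄_m, η_m ↾ n}`. -/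
noncomputable def relator (k : ℕ) (η : Fin (k + 1) → Cantor) (n : ℕ) :
    FreeAbelianGroup (Gen k) :=
  n.factorial • FreeAbelianGroup.of (Gen.y η (n + 1)) -
    (FreeAbelianGroup.of (Gen.y η n) +
      ∑ m : Fin (k + 1), FreeAbelianGroup.of (Gen.x m (dropAt η m) ((η m).restrict n)))

/-- The abelian group generated by the symbols `Gen k` freely except for the equations above. -/
abbrev ShelahGroup (k : ℕ) : Type :=
  FreeAbelianGroup (Gen k) ⧸
    AddSubgroup.closure {r | ∃ (η : Fin (k + 1) → Cantor) (n : ℕ), r = relator k η n}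

/-- The image in the group of a generator. -/
def ShelahGroup.of {k : ℕ} (g : Gen k) : ShelahGroup k :=
  QuotientAddGroup.mk (FreeAbelianGroup.of g)

/-- The defining equations hold in the group. -/
theorem ShelahGroup.equation {k : ℕ} (η : Fin (k + 1) → Cantor) (n : ℕ) :
    n.factorial • ShelahGroup.of (Gen.y η (n + 1)) = ShelahGroup.of (Gen.y η n) +
      ∑ m : Fin (k + 1), ShelahGroup.of (Gen.x m (dropAt η m) ((η m).restrict n)) := by
  have h : (QuotientAddGroup.mk (relator k η n) : ShelahGroup k) = 0 :=
    (QuotientAddGroup.eq_zero_iff _).2 (AddSubgroup.subset_closure ⟨η, n, rfl⟩)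
  have h2 : (QuotientAddGroup.mk' (AddSubgroup.closure
      {r | ∃ (η : Fin (k + 1) → Cantor) (n : ℕ), r = relator k η n})) (relator k η n) = 0 := h
  rw [relator, map_sub, map_add, map_nsmul, map_sum, sub_eq_zero] at h2
  exact h2

/-- The coding `c` is compatible with the presentation: the codes of the generators depend
continuously on their parameters from the Cantor space. -/
def HasContinuousGenerators {k : ℕ} (c : ShelahGroup k → ℕ → ℕ) : Prop :=
  (∀ (m : Fin (k + 1)) (ν : List Bool),
    Continuous fun η : {l : Fin (k + 1) // l ≠ m} → Cantor =>
      c (ShelahGroup.of (Gen.x m η ν))) ∧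
  ∀ n : ℕ, Continuous fun η : Fin (k + 1) → Cantor => c (ShelahGroup.of (Gen.y η n))

theorem linearIndependent_of_triangular {ι R : Type*} [LinearOrder ι] [CommRing R] [IsDomain R]
    {J : Set ι} (h : J → ι →₀ R) (hne : ∀ i : J, h i i ≠ 0)
    (hlt : ∀ (i : J) (j : ι), (i : ι) < j → h i j = 0) : LinearIndependent R h := by
  rw [linearIndependent_iff]
  intro l hl
  by_contra hne0
  have hs : l.support.Nonempty := Finsupp.support_nonempty_iff.2 hne0
  set i := l.support.max' hs with hi
  have h1 := DFunLike.congr_fun hl (i : ι)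
  rw [Finsupp.linearCombination_apply, Finsupp.sum, Finsupp.finsetSum_apply,
    Finset.sum_eq_single i] at h1
  · have h2 : l i ≠ 0 := Finsupp.mem_support_iff.1 (Finset.max'_mem _ hs)
    simp only [Finsupp.smul_apply, smul_eq_mul, Finsupp.coe_zero, Pi.zero_apply, mul_eq_zero] at h1
    exact h1.elim h2 (hne i)
  · intro j hj hji
    have : j < i := lt_of_le_of_ne (Finset.le_max' _ _ hj) hji
    simp [hlt j i this]
  · intro hi'
    exact absurd (Finset.max'_mem _ hs) hi'

/-- A submodule of a free module over a principal ideal domain is free. -/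
theorem Submodule.free_finsupp_of_isPrincipalIdealRing {ι R : Type*} [CommRing R] [IsDomain R]
    [IsPrincipalIdealRing R] (N : Submodule R (ι →₀ R)) : Module.Free R N := by
  classical
  obtain ⟨_, _⟩ := exists_wellFoundedLT ι
  let M (i : ι) : Submodule R (ι →₀ R) := N ⊓ Finsupp.supported R R (Set.Iic i)
  let I (i : ι) : Ideal R := (M i).map (Finsupp.lapply i)
  let g (i : ι) : R := Submodule.IsPrincipal.generator (I i)
  have hg (i : ι) : ∃ f ∈ M i, f i = g i := by
    have := Submodule.IsPrincipal.generator_mem (I i)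
    obtain ⟨f, hf, hfi⟩ := Submodule.mem_map.1 this
    exact ⟨f, hf, hfi⟩
  choose h hM hh using hg
  let J : Set ι := {i | g i ≠ 0}
  have hli : LinearIndependent R (fun i : J => h i) := by
    refine linearIndependent_of_triangular _ (fun i => ?_) (fun i j hij => ?_)
    · rw [hh]; exact i.2
    · by_contra hne
      have := (Finsupp.mem_supported R (h i)).1 (hM i).2 (Finsupp.mem_support_iff.2 hne)
      exact absurd hij (not_lt.2 this)
  have hspan : Submodule.span R (Set.range fun i : J => h i) = N := by
    apply le_antisymm
    · rw [Submodule.span_le]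
      rintro _ ⟨i, rfl⟩
      exact (hM i).1
    · have key : ∀ i : ι, ∀ f ∈ M i, f ∈ Submodule.span R (Set.range fun i : J => h i) := by
        intro i
        induction i using WellFoundedLT.induction with
        | ind i ih =>
          intro f hf
          have hfi : f i ∈ I i := Submodule.mem_map_of_mem (f := Finsupp.lapply i) hf
          obtain ⟨c, hc⟩ := (Submodule.IsPrincipal.mem_iff_eq_smul_generator (I i)).1 hfi
          have hc' : f i = c * g i := hc
          have hmem : c • h i ∈ Submodule.span R (Set.range fun i : J => h i) ∨ f i = 0 := by
            by_cases hgi : g i = 0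
            · right; rw [hc', hgi, mul_zero]
            · left; exact Submodule.smul_mem _ _ (Submodule.subset_span ⟨⟨i, hgi⟩, rfl⟩)
          have step : ∀ f' ∈ M i, f' i = 0 →
              f' ∈ Submodule.span R (Set.range fun i : J => h i) := by
            intro f' hf' h0
            by_cases hz : f' = 0
            · rw [hz]; exact zero_mem _
            have hs : f'.support.Nonempty := Finsupp.support_nonempty_iff.2 hz
            have hmax := Finset.max'_mem _ hs
            have hle := (Finsupp.mem_supported R f').1 hf'.2 hmax
            refine ih (f'.support.max' hs) (lt_of_le_of_ne hle ?_) f' ⟨hf'.1, ?_⟩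
            · intro he
              rw [he] at hmax
              exact Finsupp.mem_support_iff.1 hmax h0
            · exact (Finsupp.mem_supported R f').2 fun j hj => Finset.le_max' _ _ hj
          rcases hmem with hmem | h0
          · have := step (f - c • h i) (sub_mem hf (Submodule.smul_mem _ _ (hM i)))
              (by simp [hh, hc'])
            simpa using add_mem this hmem
          · exact step f hf h0
      intro f hf
      by_cases hz : f = 0
      · rw [hz]; exact zero_mem _
      have hs : f.support.Nonempty := Finsupp.support_nonempty_iff.2 hz
      exact key (f.support.max' hs) f
        ⟨hf, (Finsupp.mem_supported R f).2 fun j hj => Finset.le_max' _ _ hj⟩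
  have hb := Module.Free.of_basis (Module.Basis.span hli)
  rwa [hspan] at hb

theorem Submodule.free_of_free_of_isPrincipalIdealRing {R M : Type*} [CommRing R] [IsDomain R]
    [IsPrincipalIdealRing R] [AddCommGroup M] [Module R M] [Module.Free R M]
    (N : Submodule R M) : Module.Free R N := by
  let e := (Module.Free.chooseBasis R M).repr
  have := Submodule.free_finsupp_of_isPrincipalIdealRing (N.map e.toLinearMap)
  exact Module.Free.of_equiv (e.submoduleMap N).symm

theorem AddSubgroup.free_of_le {A : Type*} [AddCommGroup A] {H K : AddSubgroup A}
    (h : H ≤ K) [Module.Free ℤ K] : Module.Free ℤ H := by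
  have := Submodule.free_of_free_of_isPrincipalIdealRing (R := ℤ)
    (AddSubgroup.toIntSubmodule (H.addSubgroupOf K))
  let e : H.addSubgroupOf K ≃+ H := AddSubgroup.addSubgroupOfEquivOfLe h
  exact Module.Free.of_equiv (M := AddSubgroup.toIntSubmodule (H.addSubgroupOf K))
    e.toIntLinearEquiv

/-- If `#U ≥ ℵ_n` then `U ^ n` is not covered by sets `A m`, `m < n`, such that every line parallel
to the `m`-th axis meets `A m` in a countable set. -/
theorem exists_forall_notMem_of_countable_lines {X : Type} (n : ℕ) :
    ∀ (U : Set X) (_ : aleph ((n : ℕ) : Ordinal.{0}) ≤ #U) (A : Fin n → Set (Fin n → X))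
      (_ : ∀ (m : Fin n) (η : Fin n → X), {ζ ∈ A m | ∀ l, l ≠ m → ζ l = η l}.Countable),
      ∃ η : Fin n → X, (∀ l, η l ∈ U) ∧ ∀ m, η ∉ A m := by
  induction n with
  | zero => intro U _ A _; exact ⟨Fin.elim0, fun l => l.elim0, fun m => m.elim0⟩
  | succ n ih =>
    intro U hU A hA
    have hlt : aleph ((n : ℕ) : Ordinal.{0}) < #U := by
      refine lt_of_lt_of_le ?_ hU
      rw [aleph_lt_aleph]; exact_mod_cast Nat.lt_succ_self n
    obtain ⟨Y, hYU, hY⟩ := Cardinal.le_mk_iff_exists_subset.1 hlt.le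
    let bad : Set X := ⋃ ζ : Fin n → Y, {a | (Fin.cons a (fun l => (ζ l : X)) : Fin (n + 1) → X) ∈ A 0}
    have hline : ∀ ζ : Fin n → X,
        {a | (Fin.cons a ζ : Fin (n + 1) → X) ∈ A 0}.Countable := by
      intro ζ
      by_cases hX : Nonempty X
      · have x := Classical.choice hX
        have := hA 0 (Fin.cons x ζ)
        refine (this.preimage (f := fun a => (Fin.cons a ζ : Fin (n + 1) → X))
          (fun a b hab => by simpa using congrFun hab 0)).mono ?_
        intro a ha
        refine ⟨ha, fun l hl => ?_⟩
        obtain ⟨j, rfl⟩ := Fin.exists_succ_eq.2 hl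
        simp
      · exact (Set.countable_empty).mono fun a => absurd ⟨a⟩ hX
    have hbad : #bad < #U := by
      refine lt_of_le_of_lt ?_ hlt
      refine (Cardinal.mk_iUnion_le _).trans ?_
      have h0 : ℵ₀ ≤ aleph ((n : ℕ) : Ordinal.{0}) := aleph0_le_aleph _
      have h1 : #(Fin n → Y) ≤ aleph ((n : ℕ) : Ordinal.{0}) := by
        rw [← Cardinal.power_def, hY, mk_fin, power_natCast]
        exact power_nat_le h0
      have h2 : ⨆ ζ : Fin n → Y, #{a | (Fin.cons a (fun l => (ζ l : X)) : Fin (n + 1) → X) ∈ A 0}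
          ≤ ℵ₀ := ciSup_le' fun ζ => (hline _).le_aleph0
      exact (mul_le_mul' h1 (h2.trans h0)).trans (mul_eq_self h0).le
    obtain ⟨a, haU, ha⟩ : ∃ a ∈ U, a ∉ bad := by
      by_contra! hcon
      exact absurd (mk_le_mk_of_subset hcon) (not_le.2 hbad)
    obtain ⟨ζ, hζ, hζA⟩ := ih Y hY.ge
      (fun m => {ζ | (Fin.cons a ζ : Fin (n + 1) → X) ∈ A m.succ}) (by
        intro m η
        refine ((hA m.succ (Fin.cons a η)).preimage
          (f := fun ζ => (Fin.cons a ζ : Fin (n + 1) → X))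
          (Fin.cons_right_injective (α := fun _ => X) a)).mono ?_
        rintro ζ ⟨h1, h2⟩
        refine ⟨h1, fun l => Fin.cases ?_ (fun j hj => ?_) l⟩
        · simp
        · simpa using h2 j (fun h => hj (by rw [h])))
    refine ⟨Fin.cons a ζ, fun l => Fin.cases haU (fun j => hYU (hζ j)) l, fun m => ?_⟩
    refine Fin.cases ?_ (fun j => hζA j) m
    intro h0
    exact ha (Set.mem_iUnion.2 ⟨fun l => ⟨ζ l, hζ l⟩, h0⟩)

theorem exists_ordinal_injOn_of_le_succ {X : Type} (S : Set X) (κ : Cardinal.{0}) (hκ : ℵ₀ ≤ κ)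
    (hS : #S ≤ Order.succ κ) : ∃ f : X → Ordinal.{0}, Set.InjOn f S ∧
      ∀ s ∈ S, #{t | t ∈ S ∧ f t ≤ f s} ≤ κ := by
  classical
  obtain ⟨r, _, hr⟩ := Cardinal.exists_ord_eq S
  refine ⟨fun t => if h : t ∈ S then Ordinal.typein r ⟨t, h⟩ else 0, ?_, ?_⟩
  · intro s hs t ht hst
    simp only [hs, ht, dif_pos] at hst
    exact congrArg Subtype.val (Ordinal.typein_injective r hst)
  · intro s hs
    have hlt : #{y : S // r y ⟨s, hs⟩} ≤ κ := by
      have h1 : (Ordinal.typein r ⟨s, hs⟩).card < #S := by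
        rw [← lt_ord, hr]; exact Ordinal.typein_lt_type r _
      rw [Ordinal.card_typein] at h1
      exact Order.lt_succ_iff.1 (h1.trans_le hS)
    have hsub : {t | t ∈ S ∧ (if h : t ∈ S then Ordinal.typein r ⟨t, h⟩ else 0) ≤
        (if h : s ∈ S then Ordinal.typein r ⟨s, h⟩ else 0)} ⊆
        Set.range (fun y : {y : S // r y ⟨s, hs⟩} => (y : X)) ∪ {s} := by
      rintro t ⟨ht, hle⟩
      simp only [hs, ht, dif_pos] at hle
      rcases hle.lt_or_eq with h | h
      · exact Or.inl ⟨⟨⟨t, ht⟩, (Ordinal.typein_lt_typein r).1 h⟩, rfl⟩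
      · exact Or.inr (congrArg Subtype.val (Ordinal.typein_injective r h))
    refine (mk_le_mk_of_subset hsub).trans ((mk_union_le _ _).trans ?_)
    refine add_le_of_le hκ (mk_range_le.trans hlt) ?_
    rw [mk_singleton]
    exact one_le_aleph0.trans hκ

theorem exists_ordinal_strictMono_of_wellFoundedLT {α : Type} {L : Type*} [LinearOrder L]
    [WellFoundedLT L] (key : α → L) :
    ∃ ρ : α → Ordinal.{0}, ∀ a b, key a < key b → ρ a < ρ b :=
  have : IsWellFounded α (InvImage (· < ·) key) := ⟨InvImage.wf _ wellFounded_lt⟩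
  ⟨IsWellFounded.rank (InvImage (· < ·) key), fun _ _ h => IsWellFounded.rank_lt_of_rel h⟩

theorem exists_first_argmax {n : ℕ} {L : Type*} [LinearOrder L] (g : Fin (n + 1) → L) :
    ∃ i, (∀ j, g j ≤ g i) ∧ ∀ j < i, g j < g i := by
  obtain ⟨i₀, hi₀⟩ := Finite.exists_max g
  let T : Set (Fin (n + 1)) := {i | ∀ j, g j ≤ g i}
  have hT : T.Nonempty := ⟨i₀, hi₀⟩
  refine ⟨wellFounded_lt.min T hT, wellFounded_lt.min_mem T hT, fun j hj => ?_⟩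
  by_contra hle
  exact wellFounded_lt.not_lt_min T
    (fun l => ((wellFounded_lt.min_mem T hT) l).trans (not_lt.1 hle)) hj

/-- If `#S ≤ ℵ_k` then `S ^ (k + 1)` has a well-ordering in which every point has only finitely many
predecessors on one of the lines through it that are parallel to an axis. -/
theorem exists_rank_finite_lines {X : Type} (k : ℕ) :
    ∀ (S : Set X) (_ : #S ≤ aleph ((k : ℕ) : Ordinal.{0})),
      ∃ ρ : (Fin (k + 1) → X) → Ordinal.{0}, Set.InjOn ρ {η | ∀ l, η l ∈ S} ∧
        ∀ η, (∀ l, η l ∈ S) → ∃ m,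
          {ζ : Fin (k + 1) → X | (∀ l, ζ l ∈ S) ∧ ρ ζ < ρ η ∧ ∀ l, l ≠ m → ζ l = η l}.Finite := by
  induction k with
  | zero =>
    intro S hS
    have hc : S.Countable := by
      rw [← le_aleph0_iff_set_countable]
      simpa using hS
    obtain ⟨f, hf⟩ := Set.countable_iff_exists_injOn.1 hc
    have hinj : Set.InjOn (fun η : Fin 1 → X => f (η 0)) {η | ∀ l, η l ∈ S} := by
      intro η hη ζ hζ h
      funext l
      rw [Subsingleton.elim l 0]
      exact hf (hη 0) (hζ 0) h
    refine ⟨fun η => (f (η 0) : Ordinal.{0}), fun η hη ζ hζ h => hinj hη hζ (by simpa using h),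
      fun η hη => ⟨0, ?_⟩⟩
    refine Set.Finite.of_finite_image ((Set.finite_Iio (f (η 0))).subset ?_)
      (hinj.mono fun ζ hζ => hζ.1)
    rintro _ ⟨ζ, hζ, rfl⟩
    simpa using hζ.2.1
  | succ k ih =>
    intro S hS
    obtain ⟨f, hfS, hf⟩ := exists_ordinal_injOn_of_le_succ S (aleph ((k : ℕ) : Ordinal.{0}))
      (aleph0_le_aleph _) (by
        rw [succ_aleph]
        exact_mod_cast hS)
    have hex : ∀ s, ∃ ρ : (Fin (k + 1) → X) → Ordinal.{0}, s ∈ S →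
        Set.InjOn ρ {η | ∀ l, η l ∈ {t | t ∈ S ∧ f t ≤ f s}} ∧
        ∀ η, (∀ l, η l ∈ {t | t ∈ S ∧ f t ≤ f s}) → ∃ m,
          {ζ : Fin (k + 1) → X | (∀ l, ζ l ∈ {t | t ∈ S ∧ f t ≤ f s}) ∧ ρ ζ < ρ η ∧
            ∀ l, l ≠ m → ζ l = η l}.Finite := by
      intro s
      by_cases hs : s ∈ S
      · obtain ⟨ρ, hρ⟩ := ih _ (hf s hs)
        exact ⟨ρ, fun _ => hρ⟩
      · exact ⟨fun _ => 0, fun h => absurd h hs⟩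
    choose σ hσ using hex
    choose i hi hi' using fun η : Fin (k + 2) → X => exists_first_argmax fun l => f (η l)
    let key (η : Fin (k + 2) → X) : Ordinal.{0} ×ₗ (Fin (k + 2) ×ₗ Ordinal.{0}) :=
      toLex (f (η (i η)), toLex (i η, σ (η (i η)) (fun j => η ((i η).succAbove j))))
    have hkey : Set.InjOn key {η | ∀ l, η l ∈ S} := by
      intro η hη ζ hζ h
      have h0 := congrArg ofLex h
      simp only [key, ofLex_toLex, Prod.mk.injEq, EmbeddingLike.apply_eq_iff_eq] at h0
      obtain ⟨h1, h2, h3⟩ := h0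
      have h4 : η (i η) = ζ (i ζ) := hfS (hη _) (hζ _) h1
      rw [← h4, ← h2] at h3
      have h5 := (hσ _ (hη (i η))).1 (fun j => ⟨hη _, hi η _⟩)
        (fun j => ⟨hζ _, by rw [h4]; exact hi ζ _⟩) h3
      funext l
      by_cases hl : l = i η
      · rw [hl, h4, h2]
      · obtain ⟨j, rfl⟩ := Fin.exists_succAbove_eq hl
        exact congrFun h5 j
    obtain ⟨ρ, hρ⟩ := exists_ordinal_strictMono_of_wellFoundedLT key
    have hρ' : ∀ ζ η, (∀ l, ζ l ∈ S) → (∀ l, η l ∈ S) → ρ ζ < ρ η → key ζ < key η := by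
      intro ζ η hζ hη h
      rcases lt_trichotomy (key ζ) (key η) with h1 | h1 | h1
      · exact h1
      · exact absurd (congrArg ρ (hkey hζ hη h1)) h.ne
      · exact absurd (hρ _ _ h1) h.not_gt
    refine ⟨ρ, fun η hη ζ hζ h => ?_, fun η hη => ?_⟩
    · by_contra hne
      rcases lt_or_gt_of_ne fun h' => hne (hkey hη hζ h') with h1 | h1
      · exact (hρ _ _ h1).ne h
      · exact (hρ _ _ h1).ne h.symm
    · obtain ⟨m, hm⟩ := (hσ _ (hη (i η))).2 (fun j => η ((i η).succAbove j))
        (fun j => ⟨hη _, hi η _⟩)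
      refine ⟨(i η).succAbove m, ?_⟩
      let F : Set (Fin (k + 2) → X) := {ζ | ζ (i η) = η (i η) ∧ (fun j => ζ ((i η).succAbove j)) ∈
        {ζ : Fin (k + 1) → X | (∀ l, ζ l ∈ {t | t ∈ S ∧ f t ≤ f (η (i η))}) ∧
          σ (η (i η)) ζ < σ (η (i η)) (fun j => η ((i η).succAbove j)) ∧
            ∀ l, l ≠ m → ζ l = η ((i η).succAbove l)}}
      have hF : F.Finite := by
        refine Set.Finite.of_finite_image (f := fun ζ j => ζ ((i η).succAbove j))
          (hm.subset ?_) ?_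
        · rintro _ ⟨ζ, hζ, rfl⟩
          exact hζ.2
        · intro ζ hζ ξ hξ h
          funext l
          by_cases hl : l = i η
          · rw [hl, hζ.1, hξ.1]
          · obtain ⟨j, rfl⟩ := Fin.exists_succAbove_eq hl
            exact congrFun h j
      refine (hF.union (Set.finite_singleton
        (Function.update η ((i η).succAbove m) (η (i η))))).subset ?_
      rintro ζ ⟨hζ, hlt, hline⟩
      have hζi : ζ (i η) = η (i η) := hline _ (Fin.succAbove_ne _ _).symm
      have hle : f (η (i η)) ≤ f (ζ (i ζ)) := by rw [← hζi]; exact hi ζ _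
      have hk := hρ' ζ η hζ hη hlt
      simp only [key, Prod.Lex.toLex_lt_toLex] at hk
      rcases hk with hk | ⟨h1, hk⟩
      · exact absurd hk hle.not_gt
      have h1' : ζ (i ζ) = η (i η) := hfS (hζ _) (hη _) h1
      rcases hk with h2 | ⟨h2, h3⟩
      · right
        have hm' : i ζ = (i η).succAbove m := by
          by_contra hne
          have := hi' η _ h2
          rw [← hline _ hne, h1'] at this
          exact lt_irrefl _ this
        funext l
        by_cases hl : l = (i η).succAbove m
        · rw [hl, Function.update_self, ← hm', h1']
        · rw [Function.update_of_ne hl, hline l hl]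
      · left
        simp only [h2, hζi] at h3
        refine ⟨hζi, fun j => ⟨hζ _, ?_⟩, h3, fun l hl => hline _ fun h =>
          hl (Fin.succAbove_right_injective h)⟩
        rw [← h1']; exact hi ζ _

namespace ShelahGroup

variable {k : ℕ}

theorem exists_seq_with_value {W : Type*} [AddCommGroup W] [Module ℚ W] (s : ℕ → W) (n : ℕ)
    (w : W) : ∃ t : ℕ → W, t n = w ∧ ∀ i, i.factorial • t (i + 1) = t i + s i := by
  let T (a : W) : ℕ → W := fun i =>
    Nat.rec a (fun i b => (i.factorial : ℚ)⁻¹ • (b + s i)) i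
  have hT : ∀ a i, i.factorial • T a (i + 1) = T a i + s i := by
    intro a i
    have : T a (i + 1) = (i.factorial : ℚ)⁻¹ • (T a i + s i) := rfl
    rw [this, ← Nat.cast_smul_eq_nsmul ℚ, smul_inv_smul₀]
    exact_mod_cast i.factorial_ne_zero
  have hsurj : ∀ n w, ∃ a, T a n = w := by
    intro n
    induction n with
    | zero => exact fun w => ⟨w, rfl⟩
    | succ n ih =>
      intro w
      obtain ⟨a, ha⟩ := ih ((n.factorial : ℚ) • w - s n)
      refine ⟨a, ?_⟩
      change (n.factorial : ℚ)⁻¹ • (T a n + s n) = w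
      rw [ha, sub_add_cancel, inv_smul_smul₀]
      exact_mod_cast n.factorial_ne_zero
  obtain ⟨a, ha⟩ := hsurj n w
  exact ⟨T a, ha, hT a⟩

/-- A homomorphism into a rational vector space can be prescribed on all `x`'s and on one of the
`y_{η, n}` for each `η`. -/
theorem exists_hom {W : Type*} [AddCommGroup W] [Module ℚ W]
    (f : Gen k → W) (n₀ : (Fin (k + 1) → Cantor) → ℕ) :
    ∃ ψ : ShelahGroup k →+ W, (∀ m p ν, ψ (of (Gen.x m p ν)) = f (Gen.x m p ν)) ∧
      ∀ η, ψ (of (Gen.y η (n₀ η))) = f (Gen.y η (n₀ η)) := by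
  choose t ht0 ht using fun η : Fin (k + 1) → Cantor => exists_seq_with_value
    (fun n => ∑ m, f (Gen.x m (dropAt η m) ((η m).restrict n))) (n₀ η) (f (Gen.y η (n₀ η)))
  let g : Gen k → W
    | Gen.x m p ν => f (Gen.x m p ν)
    | Gen.y η n => t η n
  have hker : AddSubgroup.closure {r | ∃ (η : Fin (k + 1) → Cantor) (n : ℕ), r = relator k η n} ≤
      (FreeAbelianGroup.lift g).ker := by
    rw [AddSubgroup.closure_le]
    rintro _ ⟨η, n, rfl⟩
    simp only [SetLike.mem_coe, AddMonoidHom.mem_ker, relator, map_sub, map_add, map_nsmul,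
      map_sum, FreeAbelianGroup.lift_apply_of, g, ht]
    exact sub_self _
  have hof : ∀ x, QuotientAddGroup.lift _ (FreeAbelianGroup.lift g) hker (of x) = g x := by
    intro x
    rw [of, QuotientAddGroup.lift_mk, FreeAbelianGroup.lift_apply_of]
  exact ⟨QuotientAddGroup.lift _ (FreeAbelianGroup.lift g) hker, fun m p ν => hof _,
    fun η => (hof _).trans (ht0 η)⟩

theorem closure_range_of : AddSubgroup.closure (Set.range (of (k := k))) = ⊤ := by
  rw [eq_top_iff]
  rintro a -
  obtain ⟨a, rfl⟩ := QuotientAddGroup.mk_surjective a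
  induction a using FreeAbelianGroup.induction_on with
  | zero => exact zero_mem _
  | of x => exact AddSubgroup.subset_closure ⟨x, rfl⟩
  | neg x hx => exact neg_mem hx
  | add x y hx hy => exact add_mem hx hy

theorem hom_equation {W : Type*} [AddCommGroup W] (ψ : ShelahGroup k →+ W)
    (η : Fin (k + 1) → Cantor) (n : ℕ) :
    n.factorial • ψ (of (Gen.y η (n + 1))) = ψ (of (Gen.y η n)) +
      ∑ m, ψ (of (Gen.x m (dropAt η m) ((η m).restrict n))) := by
  rw [← map_nsmul, equation, map_add, map_sum]

end ShelahGroup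

/-- The generators without their parameters from the Cantor space. -/
abbrev GenShape (k : ℕ) : Type := (Fin (k + 1) × List Bool) ⊕ ℕ

/-- The generator of given shape and parameters; an `x_{m, η̄, ν}` ignores `η̄ m`. -/
def GenShape.gen {k : ℕ} : GenShape k → (Fin (k + 1) → Cantor) → Gen k
  | Sum.inl (m, ν), η => Gen.x m (dropAt η m) ν
  | Sum.inr n, η => Gen.y η n

theorem exists_dropAt_eq {k : ℕ} {S : Set Cantor} (hS : S.Nonempty) (m : Fin (k + 1))
    (p : {l : Fin (k + 1) // l ≠ m} → Cantor) (hp : ∀ l, p l ∈ S) :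
    ∃ η : Fin (k + 1) → Cantor, (∀ l, η l ∈ S) ∧ dropAt η m = p := by
  classical
  obtain ⟨a, ha⟩ := hS
  refine ⟨fun l => if h : l ≠ m then p ⟨l, h⟩ else a, fun l => ?_, ?_⟩
  · dsimp only
    split_ifs
    exacts [hp _, ha]
  · funext l
    simp [dropAt, l.2]

theorem GenShape.exists_gen_eq {k : ℕ} (g : Gen k) :
    ∃ (s : GenShape k) (η : Fin (k + 1) → Cantor), s.gen η = g := by
  cases g with
  | x m p ν =>
    obtain ⟨η, -, h⟩ := exists_dropAt_eq (S := Set.univ) ⟨fun _ => false, trivial⟩ m p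
      fun _ => trivial
    exact ⟨Sum.inl (m, ν), η, by rw [GenShape.gen, h]⟩
  | y η n => exact ⟨Sum.inr n, η, rfl⟩

theorem dropAt_eq_iff {k : ℕ} {η ζ : Fin (k + 1) → Cantor} {m : Fin (k + 1)} :
    dropAt ζ m = dropAt η m ↔ ∀ l, l ≠ m → ζ l = η l :=
  ⟨fun h l hl => congrFun h ⟨l, hl⟩, fun h => funext fun l => h l.1 l.2⟩

theorem Cantor.length_restrict (η : Cantor) (n : ℕ) : (η.restrict n).length = n := by
  simp [Cantor.restrict]

theorem Cantor.restrict_eq_restrict_iff {η ζ : Cantor} {n : ℕ} :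
    η.restrict n = ζ.restrict n ↔ ∀ i < n, η i = ζ i := by
  rw [Cantor.restrict, Cantor.restrict, List.ofFn_inj, funext_iff]
  exact ⟨fun h i hi => h ⟨i, hi⟩, fun h i => h i i.2⟩

namespace ShelahGroup

variable {k : ℕ}

/-- The subgroup generated by the generators with parameters in `S`. -/
def parametrized (k : ℕ) (S : Set Cantor) : AddSubgroup (ShelahGroup k) :=
  AddSubgroup.closure {a | ∃ (s : GenShape k) (η : Fin (k + 1) → Cantor),
    (∀ l, η l ∈ S) ∧ a = of (s.gen η)}

theorem parametrized_mono {S T : Set Cantor} (h : S ⊆ T) : parametrized k S ≤ parametrized k T :=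
  AddSubgroup.closure_mono fun _ ⟨s, η, hη, ha⟩ => ⟨s, η, fun l => h (hη l), ha⟩

theorem parametrized_univ : parametrized k Set.univ = ⊤ := by
  rw [eq_top_iff, ← closure_range_of, AddSubgroup.closure_le]
  rintro _ ⟨g, rfl⟩
  obtain ⟨s, η, rfl⟩ := GenShape.exists_gen_eq g
  exact AddSubgroup.subset_closure ⟨s, η, fun _ => trivial, rfl⟩

theorem exists_finite_mem_parametrized (a : ShelahGroup k) :
    ∃ T : Set Cantor, T.Finite ∧ a ∈ parametrized k T := by
  have ha : a ∈ parametrized k Set.univ := by rw [parametrized_univ]; trivial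
  induction ha using AddSubgroup.closure_induction with
  | mem a ha =>
    obtain ⟨s, η, -, rfl⟩ := ha
    exact ⟨Set.range η, Set.finite_range η,
      AddSubgroup.subset_closure ⟨s, η, fun l => ⟨l, rfl⟩, rfl⟩⟩
  | zero => exact ⟨∅, Set.finite_empty, zero_mem _⟩
  | add a b _ _ iha ihb =>
    obtain ⟨T, hT, haT⟩ := iha
    obtain ⟨T', hT', hbT⟩ := ihb
    exact ⟨T ∪ T', hT.union hT', add_mem (parametrized_mono Set.subset_union_left haT)
      (parametrized_mono Set.subset_union_right hbT)⟩
  | neg a _ iha =>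
    obtain ⟨T, hT, haT⟩ := iha
    exact ⟨T, hT, neg_mem haT⟩

theorem exists_parametrized_ge {κ : Cardinal.{0}} (hκ : ℵ₀ ≤ κ) (H : AddSubgroup (ShelahGroup k))
    (hH : #H ≤ κ) : ∃ S : Set Cantor, #S ≤ κ ∧ H ≤ parametrized k S := by
  choose T hT hmem using exists_finite_mem_parametrized (k := k)
  refine ⟨⋃ a : H, T a, ?_, fun a ha =>
    parametrized_mono (Set.subset_iUnion (fun a : H => T a) ⟨a, ha⟩) (hmem a)⟩
  refine (Cardinal.mk_iUnion_le _).trans ((mul_le_mul' hH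
    (ciSup_le' fun a : H => ((hT a).countable.le_aleph0).trans hκ)).trans (mul_eq_self hκ).le)

theorem mk_parametrized_le {κ : Cardinal.{0}} (hκ : ℵ₀ ≤ κ) {S : Set Cantor} (hS : #S ≤ κ) :
    #(parametrized k S) ≤ κ := by
  let v : (GenShape k × (Fin (k + 1) → S)) → ShelahGroup k := fun q =>
    of (q.1.gen fun l => q.2 l)
  have hv : parametrized k S ≤
      (Submodule.span ℤ (Set.range v)).toAddSubgroup := by
    rw [parametrized, AddSubgroup.closure_le]
    rintro _ ⟨s, η, hη, rfl⟩
    exact Submodule.subset_span ⟨(s, fun l => ⟨η l, hη l⟩), rfl⟩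
  have hr : (parametrized k S : Set (ShelahGroup k)) ⊆
      Set.range (Finsupp.linearCombination ℤ v) := by
    intro a ha
    have := hv ha
    rw [Submodule.mem_toAddSubgroup, Finsupp.mem_span_range_iff_exists_finsupp] at this
    obtain ⟨c, hc⟩ := this
    exact ⟨c, hc⟩
  have hcard : #(GenShape k × (Fin (k + 1) → S)) ≤ κ := by
    rw [mk_prod, lift_id, lift_id, ← Cardinal.power_def (S : Type) (Fin (k + 1)), mk_fin,
      power_natCast]
    exact (mul_le_mul' ((mk_le_aleph0).trans hκ)
      ((Cardinal.power_le_power_right hS).trans (power_nat_le hκ))).trans (mul_eq_self hκ).le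
  refine (mk_le_mk_of_subset hr).trans (mk_range_le.trans ?_)
  rcases isEmpty_or_nonempty (GenShape k × (Fin (k + 1) → S)) with hI | hI
  · exact (le_one_iff_subsingleton.2 inferInstance).trans (one_le_aleph0.trans hκ)
  · rw [mk_finsupp_of_infinite']
    exact max_le hcard (mk_le_aleph0.trans hκ)

end ShelahGroup

theorem exists_rec_of_rank {α W : Type*} [Zero W] (R : α → Ordinal.{0})
    (F : α → (α → W) → W) : ∃ f : α → W, ∀ g,
      f g = F g (fun g' => open scoped Classical in if R g' < R g then f g' else 0) := by
  classical
  have hwf : WellFounded (InvImage (· < ·) R) := InvImage.wf _ wellFounded_lt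
  refine ⟨hwf.fix fun g rec => F g fun g' => if h : R g' < R g then rec g' h else 0, fun g => ?_⟩
  rw [hwf.fix_eq]
  simp only [dite_eq_ite]

theorem Gen.x_dropAt_inj {k : ℕ} {m m' : Fin (k + 1)} {η ζ : Fin (k + 1) → Cantor}
    {ν ν' : List Bool} (h : Gen.x m (dropAt η m) ν = Gen.x m' (dropAt ζ m') ν') :
    m = m' ∧ dropAt η m = dropAt ζ m ∧ ν = ν' := by
  rw [Gen.x.injEq] at h
  obtain ⟨rfl, h1, h2⟩ := h
  exact ⟨rfl, eq_of_heq h1, h2⟩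

theorem exists_rank_restrict_ne {k : ℕ} (S : Set Cantor) (hS : #S ≤ aleph ((k : ℕ) : Ordinal.{0})) :
    ∃ (ρ : (Fin (k + 1) → Cantor) → Ordinal.{0}) (m : (Fin (k + 1) → Cantor) → Fin (k + 1))
      (n₀ : (Fin (k + 1) → Cantor) → ℕ), Set.InjOn ρ {η | ∀ l, η l ∈ S} ∧
      ∀ η ζ, (∀ l, η l ∈ S) → (∀ l, ζ l ∈ S) → ρ ζ < ρ η → dropAt ζ (m η) = dropAt η (m η) →
        ∀ n, n₀ η ≤ n → (ζ (m η)).restrict n ≠ (η (m η)).restrict n := by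
  obtain ⟨ρ, hρ, h⟩ := exists_rank_finite_lines k S hS
  have hex : ∀ η, ∃ (m : Fin (k + 1)) (n₀ : ℕ), (∀ l, η l ∈ S) →
      ∀ ζ, (∀ l, ζ l ∈ S) → ρ ζ < ρ η → dropAt ζ m = dropAt η m →
        ∀ n, n₀ ≤ n → (ζ m).restrict n ≠ (η m).restrict n := by
    intro η
    by_cases hη : ∀ l, η l ∈ S
    · obtain ⟨m, hm⟩ := h η hη
      have hev := (Filter.eventually_all_finite (l := Filter.atTop)
        (p := fun ζ n => (ζ m).restrict n ≠ (η m).restrict n) hm).2 (by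
          rintro ζ ⟨-, hlt, hl⟩
          have hne : ζ m ≠ η m := by
            intro he
            refine hlt.ne (congrArg ρ (funext fun l => ?_))
            by_cases hlm : l = m
            · rw [hlm, he]
            · exact hl l hlm
          obtain ⟨i, hi⟩ := Function.ne_iff.1 hne
          filter_upwards [Filter.eventually_gt_atTop i] with n hn he
          exact hi (Cantor.restrict_eq_restrict_iff.1 he i hn))
      obtain ⟨n₀, hn₀⟩ := Filter.eventually_atTop.1 hev
      exact ⟨m, n₀, fun _ ζ hζ hlt hd n hn => hn₀ n hn ζ ⟨hζ, hlt, dropAt_eq_iff.1 hd⟩⟩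
    · exact ⟨0, 0, fun h => absurd h hη⟩
  choose m n₀ hmn using hex
  exact ⟨ρ, m, n₀, hρ, fun η ζ hη hζ => hmn η hη ζ hζ⟩

namespace ShelahGroup

variable {k : ℕ}

theorem free_of_le_parametrized {S : Set Cantor} (hS : #S ≤ aleph ((k : ℕ) : Ordinal.{0}))
    (H : AddSubgroup (ShelahGroup k)) (hH : H ≤ parametrized k S) : Module.Free ℤ H := by
  classical
  obtain ⟨ρ, m, n₀, hρ, hne⟩ := exists_rank_restrict_ne S hS
  let X (m' : Fin (k + 1)) (η : Fin (k + 1) → Cantor) (n : ℕ) : Gen k :=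
    Gen.x m' (dropAt η m') ((η m').restrict n)
  let Elim (g : Gen k) (η : Fin (k + 1) → Cantor) (n : ℕ) : Prop :=
    (∀ l, η l ∈ S) ∧ n₀ η ≤ n ∧ g = X (m η) η n
  have helim : ∀ {g ζ n}, Elim g ζ n → ∀ {m' η n'}, (∀ l, η l ∈ S) → g = X m' η n' →
      n = n' ∧ m' = m ζ ∧ ρ ζ ≤ ρ η := by
    rintro g ζ n ⟨hζ, hn, hg⟩ m' η n' hη hg'
    obtain ⟨h1, h2, h3⟩ := Gen.x_dropAt_inj (hg.symm.trans hg')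
    subst h1
    have hnn : n = n' := by
      rw [← Cantor.length_restrict (ζ (m ζ)) n, h3, Cantor.length_restrict]
    refine ⟨hnn, rfl, not_lt.1 fun hlt => ?_⟩
    subst hnn
    exact hne ζ η hζ hη hlt h2.symm n hn h3.symm
  have huniq : ∀ {g ζ n η n'}, Elim g ζ n → Elim g η n' → η = ζ ∧ n' = n := by
    intro g ζ n η n' h1 h2
    obtain ⟨a1, -, a3⟩ := helim h1 h2.1 h2.2.2
    obtain ⟨-, -, b3⟩ := helim h2 h1.1 h1.2.2
    exact ⟨hρ h2.1 h1.1 (le_antisymm b3 a3), a1.symm⟩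
  have hq : ∀ g, ∃ q : (Fin (k + 1) → Cantor) × ℕ, (∃ η n, Elim g η n) → Elim g q.1 q.2 := by
    intro g
    by_cases h : ∃ η n, Elim g η n
    · obtain ⟨η, n, h⟩ := h
      exact ⟨(η, n), fun _ => h⟩
    · exact ⟨(fun _ _ => false, 0), fun h' => absurd h' h⟩
  choose q hq using hq
  let R (g : Gen k) : Ordinal.{0} := if ∃ η n, Elim g η n then Order.succ (ρ (q g).1) else 0
  have hR : ∀ {g η n}, Elim g η n → R g = Order.succ (ρ η) := by
    intro g η n h
    have hex : ∃ η n, Elim g η n := ⟨η, n, h⟩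
    simp only [R, if_pos hex]
    rw [(huniq h (hq g hex)).1]
  have hRlt : ∀ {g η n}, Elim g η n → ∀ m', m' ≠ m η → R (X m' η n) < R g := by
    intro g η n h m' hm'
    rw [hR h]
    by_cases hex : ∃ ζ n', Elim (X m' η n) ζ n'
    · obtain ⟨ζ, n', h'⟩ := hex
      rw [hR h', Order.succ_lt_succ_iff]
      obtain ⟨-, h2, h3⟩ := helim h' h.1 rfl
      refine lt_of_le_of_ne h3 fun he => hm' ?_
      rw [h2, hρ h'.1 h.1 he]
    · simp only [R, if_neg hex]
      exact Order.bot_lt_succ _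
  let W := Gen k →₀ ℚ
  let e (g : Gen k) : W := Finsupp.single g 1
  obtain ⟨f, hf⟩ := exists_rec_of_rank R (W := W) fun g rec =>
    if ∃ η n, Elim g η n then
      (q g).2.factorial • e (Gen.y (q g).1 ((q g).2 + 1)) - e (Gen.y (q g).1 (q g).2) -
        ∑ m' ∈ Finset.univ.erase (m (q g).1), rec (X m' (q g).1 (q g).2)
    else e g
  have hf1 : ∀ {g η n}, Elim g η n →
      n.factorial • e (Gen.y η (n + 1)) = e (Gen.y η n) + ∑ m', f (X m' η n) := by
    intro g η n h
    have hex : ∃ η n, Elim g η n := ⟨η, n, h⟩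
    have h1 := hf g
    rw [if_pos hex] at h1
    obtain ⟨hq1, hq2⟩ := huniq h (hq g hex)
    rw [hq1, hq2, Finset.sum_congr rfl (g := fun m' => f (X m' η n)) fun m' hm' =>
      if_pos (hRlt h m' (Finset.ne_of_mem_erase hm'))] at h1
    rw [← Finset.add_sum_erase _ _ (Finset.mem_univ (m η)), ← h.2.2, h1]
    abel
  have hf2 : ∀ {g}, (¬ ∃ η n, Elim g η n) → f g = e g := by
    intro g h
    rw [hf g, if_neg h]
  have hfy : ∀ η n, f (Gen.y η n) = e (Gen.y η n) := by
    intro η n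
    refine hf2 ?_
    rintro ⟨ζ, n', -, -, h⟩
    cases h
  obtain ⟨ψ, hψx, hψy⟩ := exists_hom f n₀
  have hψy' : ∀ η, (∀ l, η l ∈ S) → ∀ n, n₀ η ≤ n →
      ψ (of (Gen.y η n)) = e (Gen.y η n) := by
    intro η hη n hn
    induction n, hn using Nat.le_induction with
    | base => rw [hψy, hfy]
    | succ n hn ih =>
      have h1 := hom_equation ψ η n
      rw [ih, Finset.sum_congr rfl fun m' _ => hψx _ _ _] at h1
      have h2 := h1.trans (hf1 (g := X (m η) η n) ⟨hη, hn, rfl⟩).symm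
      exact smul_right_injective W n.factorial_ne_zero h2
  let B : Set (Gen k) := {g | (∃ η n, (∀ l, η l ∈ S) ∧ n₀ η ≤ n ∧ g = Gen.y η n) ∨
    ((∃ m p ν, g = Gen.x m p ν) ∧ ¬ ∃ η n, Elim g η n)}
  have hψB : ∀ b : B, ψ (of (b : Gen k)) = e b := by
    rintro ⟨b, ⟨η, n, hη, hn, rfl⟩ | ⟨⟨m', p, ν, rfl⟩, h⟩⟩
    · exact hψy' η hη n hn
    · exact (hψx _ _ _).trans (hf2 h)
  have hli : LinearIndependent ℤ (fun b : B => (of (b : Gen k) : ShelahGroup k)) := by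
    refine LinearIndependent.of_comp ψ.toIntLinearMap ?_
    have h1 : LinearIndependent ℚ (fun b : B => e b) :=
      (Finsupp.linearIndependent_single_one ℚ (Gen k)).comp _ Subtype.val_injective
    have h2 := h1.restrict_scalars' ℤ
    have hfun : (ψ.toIntLinearMap ∘ fun b : B => (of (b : Gen k) : ShelahGroup k)) =
        fun b : B => e b := funext hψB
    rw [hfun]
    exact h2
  set N := Submodule.span ℤ (Set.range fun b : B => (of (b : Gen k) : ShelahGroup k)) with hN
  have hyN : ∀ η, (∀ l, η l ∈ S) → ∀ n, n₀ η ≤ n → of (Gen.y η n) ∈ N := fun η hη n hn =>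
    Submodule.subset_span ⟨⟨_, Or.inl ⟨η, n, hη, hn, rfl⟩⟩, rfl⟩
  have hxN : ∀ (o : Ordinal.{0}) (m' p ν), R (Gen.x m' p ν) = o → of (Gen.x m' p ν) ∈ N := by
    intro o
    induction o using WellFoundedLT.induction with
    | ind o ih =>
      intro m' p ν ho
      by_cases h : ∃ η n, Elim (Gen.x m' p ν) η n
      · obtain ⟨η, n, h⟩ := h
        have h1 := equation η n
        rw [← Finset.add_sum_erase _ _ (Finset.mem_univ (m η)), ← add_assoc] at h1
        rw [h.2.2]
        have h2 : of (X (m η) η n) = n.factorial • of (Gen.y η (n + 1)) - of (Gen.y η n) -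
            ∑ m' ∈ Finset.univ.erase (m η), of (X m' η n) := by
          rw [h1]
          abel
        rw [h2]
        refine sub_mem (sub_mem (nsmul_mem (hyN η h.1 _ (h.2.1.trans n.le_succ)) _)
          (hyN η h.1 n h.2.1)) (sum_mem fun m' hm' => ?_)
        exact ih _ (ho ▸ hRlt h m' (Finset.ne_of_mem_erase hm')) _ _ _ rfl
      · exact Submodule.subset_span ⟨⟨_, Or.inr ⟨⟨m', p, ν, rfl⟩, h⟩⟩, rfl⟩
  have hyN' : ∀ η, (∀ l, η l ∈ S) → ∀ d n, n₀ η ≤ n + d → of (Gen.y η n) ∈ N := by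
    intro η hη d
    induction d with
    | zero => exact hyN η hη
    | succ d ih =>
      intro n hn
      rw [← add_sub_cancel_right (of (Gen.y η n)) (∑ m', of (X m' η n)), ← equation η n]
      exact sub_mem (nsmul_mem (ih _ (by omega)) _) (sum_mem fun _ _ => hxN _ _ _ _ rfl)
  have hle : parametrized k S ≤ N.toAddSubgroup := by
    rw [parametrized, AddSubgroup.closure_le]
    rintro _ ⟨s, η, hη, rfl⟩
    rcases s with ⟨m', ν⟩ | n
    · exact hxN _ _ _ _ rfl
    · exact hyN' η hη (n₀ η) n (Nat.le_add_left _ _)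
  have : Module.Free ℤ N := Module.Free.of_basis (Module.Basis.span hli)
  exact AddSubgroup.free_of_le (K := N.toAddSubgroup) (hH.trans hle)

end ShelahGroup

theorem Int.eq_zero_of_factorial_mul_eq {a : ℕ → ℤ} (h : ∀ n : ℕ, (n.factorial : ℤ) * a (n + 1) = a n) :
    a 0 = 0 := by
  have hdvd : ∀ n : ℕ, (n.factorial : ℤ) ∣ a 0 := by
    have key : ∀ n, ∃ b : ℤ, a 0 = b * a n := by
      intro n
      induction n with
      | zero => exact ⟨1, by ring⟩
      | succ n ih =>
        obtain ⟨b, hb⟩ := ih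
        exact ⟨b * n.factorial, by rw [hb, ← h n]; ring⟩
    intro n
    obtain ⟨b, hb⟩ := key n
    exact ⟨b * a (n + 1), by rw [hb, ← h n]; ring⟩
  by_contra h0
  have h1 := Int.natAbs_dvd_natAbs.2 (hdvd ((a 0).natAbs + 3))
  rw [Int.natAbs_natCast] at h1
  have h2 := Nat.le_of_dvd (Int.natAbs_pos.2 h0) h1
  have h3 := Nat.self_le_factorial ((a 0).natAbs + 3)
  omega

namespace ShelahGroup

variable {k : ℕ}

theorem exists_yCoordinate (k : ℕ) : ∃ π : (Fin (k + 1) → Cantor) → ShelahGroup k →+ ℚ,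
    (∀ η, π η (of (Gen.y η 0)) = 1) ∧ ∀ a, {η | π η a ≠ 0}.Finite := by
  classical
  let f (η : Fin (k + 1) → Cantor) : Gen k → ℚ
    | Gen.x _ _ _ => 0
    | Gen.y ζ _ => if ζ = η then 1 else 0
  choose π hx hy using fun η => exists_hom (f η) (fun _ => 0)
  have hy0 : ∀ η ζ, ζ ≠ η → ∀ n, π η (of (Gen.y ζ n)) = 0 := by
    intro η ζ hne n
    induction n with
    | zero => rw [hy]; exact if_neg hne
    | succ n ih =>
      have h1 := hom_equation (π η) ζ n
      rw [ih, Finset.sum_eq_zero fun m _ => hx η _ _ _, add_zero] at h1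
      exact (smul_eq_zero.1 h1).resolve_left n.factorial_ne_zero
  refine ⟨π, fun η => by rw [hy]; exact if_pos rfl, fun a => ?_⟩
  have ha : a ∈ AddSubgroup.closure (Set.range (of (k := k))) := by
    rw [closure_range_of]; trivial
  induction ha using AddSubgroup.closure_induction with
  | mem a ha =>
    obtain ⟨g, rfl⟩ := ha
    cases g with
    | x m p ν => exact Set.finite_empty.subset fun η h => h (hx η _ _ _)
    | y ζ n =>
      refine (Set.finite_singleton ζ).subset fun η h => ?_
      by_contra hne
      exact h (hy0 η ζ (Ne.symm hne) n)
  | zero => simp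
  | add a b _ _ iha ihb =>
    refine (iha.union ihb).subset fun η h => ?_
    by_contra hcon
    simp only [Set.mem_union, Set.mem_ofPred_eq, not_or, not_not] at hcon
    exact h (by rw [map_add, hcon.1, hcon.2, add_zero])
  | neg a _ iha => simpa using iha

theorem mk_le_of_free {U : Set Cantor} {H : AddSubgroup (ShelahGroup k)}
    (hU : parametrized k U ≤ H) [Module.Free ℤ H] : #U ≤ aleph ((k : ℕ) : Ordinal.{0}) := by
  by_contra hlt
  have hU1 : aleph ((k + 1 : ℕ) : Ordinal.{0}) ≤ #U := by
    have := Order.succ_le_of_lt (not_le.1 hlt)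
    rw [succ_aleph] at this
    exact_mod_cast this
  obtain ⟨π, hπ, hfin⟩ := exists_yCoordinate k
  let b := Module.Free.chooseBasis ℤ H
  let T (m : Fin (k + 1)) (p : {l : Fin (k + 1) // l ≠ m} → Cantor) :
      Set (Module.Free.ChooseBasisIndex ℤ H) :=
    {i | ∃ ν, ∃ h : of (Gen.x m p ν) ∈ H, b.repr ⟨_, h⟩ i ≠ 0}
  have hT : ∀ m p, (T m p).Countable := by
    intro m p
    have : T m p = ⋃ ν, ⋃ h : of (Gen.x m p ν) ∈ H, {i | b.repr ⟨_, h⟩ i ≠ 0} := by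
      ext i; simp [T]
    rw [this]
    refine Set.countable_iUnion fun ν => Set.countable_iUnion fun h => ?_
    exact ((b.repr ⟨_, h⟩).hasFiniteSupport).countable
  let A (m : Fin (k + 1)) : Set (Fin (k + 1) → Cantor) :=
    {η | ∃ i ∈ T m (dropAt η m), π η (b i : ShelahGroup k) ≠ 0}
  obtain ⟨η, hηU, hηA⟩ := exists_forall_notMem_of_countable_lines (k + 1) U hU1 A (by
    intro m η
    have hc : (⋃ i ∈ T m (dropAt η m), {ζ | π ζ (b i : ShelahGroup k) ≠ 0}).Countable :=
      (hT m _).biUnion fun i _ => (hfin _).countable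
    refine hc.mono ?_
    rintro ζ ⟨⟨i, hi, hne⟩, hl⟩
    rw [dropAt_eq_iff.2 hl] at hi
    exact Set.mem_biUnion hi hne)
  have hgen : ∀ s : GenShape k, of (s.gen η) ∈ H := fun s =>
    hU (AddSubgroup.subset_closure ⟨s, η, hηU, rfl⟩)
  let Y (n : ℕ) : H := ⟨of (Gen.y η n), hgen (Sum.inr n)⟩
  let X (m : Fin (k + 1)) (n : ℕ) : H :=
    ⟨of (Gen.x m (dropAt η m) ((η m).restrict n)), hgen (Sum.inl (m, (η m).restrict n))⟩
  have heq : ∀ n, n.factorial • Y (n + 1) = Y n + ∑ m, X m n := by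
    intro n
    apply Subtype.ext
    simpa [Y, X] using equation η n
  have hsupp : ∀ i, (∀ m, i ∉ T m (dropAt η m)) → b.repr (Y 0) i = 0 := by
    intro i hi
    refine Int.eq_zero_of_factorial_mul_eq (a := fun n => b.repr (Y n) i) fun n => ?_
    have h1 := congrArg (fun v => b.repr v i) (heq n)
    have h2 : ∀ m, b.repr (X m n) i = 0 := by
      intro m
      by_contra hne
      exact hi m ⟨_, _, hne⟩
    simpa [h2] using h1
  have hsum := congrArg (fun v : H => π η (v : ShelahGroup k)) (b.linearCombination_repr (Y 0))
  have hzero : π η ((Finsupp.linearCombination ℤ b (b.repr (Y 0)) : H) : ShelahGroup k) = 0 := by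
    rw [Finsupp.linearCombination_apply, Finsupp.sum, AddSubgroup.val_finsetSum, map_sum]
    refine Finset.sum_eq_zero fun i hi => ?_
    have hiT : ∃ m, i ∈ T m (dropAt η m) := by
      by_contra! hcon
      exact Finsupp.mem_support_iff.1 hi (hsupp i hcon)
    obtain ⟨m, hm⟩ := hiT
    have h0 : π η (b i : ShelahGroup k) = 0 := by
      by_contra hne
      exact hηA m ⟨i, hm, hne⟩
    rw [AddSubgroup.coe_zsmul, map_zsmul, h0, smul_zero]
  have hone := hsum.symm.trans hzero
  exact one_ne_zero ((hπ η).symm.trans hone)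

end ShelahGroup

theorem isFSigmaSet_iUnion_range {ι K X : Type} [Countable ι] [Nonempty ι] [TopologicalSpace K]
    [CompactSpace K] [TopologicalSpace X] [T2Space X] {g : ι → K → X}
    (hg : ∀ i, Continuous (g i)) : IsFSigmaSet X (⋃ i, Set.range (g i)) := by
  obtain ⟨e, he⟩ := exists_surjective_nat ι
  exact ⟨fun n => Set.range (g (e n)), fun n => (isCompact_range (hg _)).isClosed,
    (he.iUnion_comp fun i => Set.range (g i)).symm⟩

theorem IsFSigmaSet.isBorelSet {X : Type} [TopologicalSpace X] {s : Set X}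
    (h : IsFSigmaSet X s) : IsBorelSet X s := by
  obtain ⟨F, hF, rfl⟩ := h
  let _ : MeasurableSpace X := borel X
  have : BorelSpace X := ⟨rfl⟩
  exact MeasurableSet.iUnion fun n => (hF n).measurableSet

theorem IsCodingIn.mono {Γ Δ : ∀ (X : Type) [TopologicalSpace X], Set X → Prop}
    (h : ∀ (X : Type) [TopologicalSpace X] (s : Set X), Γ X s → Δ X s)
    {A : Type} [AddCommGroup A] {c : A → ℕ → ℕ} (hc : IsCodingIn Γ c) : IsCodingIn Δ c :=
  ⟨hc.injective, h _ _ hc.carrier, h _ _ hc.add_graph, h _ _ hc.neg_graph⟩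

theorem isLocallyConstant_of_initial {ι Z : Type*} [Finite ι] {f : (ι → Cantor) → Z} (N : ℕ)
    (h : ∀ p q : ι → Cantor, (∀ l, (p l).restrict N = (q l).restrict N) → f p = f q) :
    IsLocallyConstant f := by
  rw [IsLocallyConstant.iff_eventually_eq]
  intro p
  have hev : ∀ᶠ q : ι → Cantor in nhds p, ∀ l, ∀ i ∈ Finset.range N, q l i = p l i := by
    rw [Filter.eventually_all]
    intro l
    rw [Filter.eventually_all_finset]
    intro i _
    have hc : Continuous fun q : ι → Cantor => q l i := by fun_prop
    exact (hc.tendsto p).eventually (by simp [nhds_discrete] : ∀ᶠ b in nhds (p l i), b = p l i)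
  filter_upwards [hev] with q hq
  exact h q p fun l => Cantor.restrict_eq_restrict_iff.2 fun i hi => hq l i (Finset.mem_range.2 hi)

theorem eventually_exists_restrict_ne {ι : Type*} {p q : ι → Cantor} (h : p ≠ q) :
    ∀ᶠ j in Filter.atTop, ∃ l, (p l).restrict j ≠ (q l).restrict j := by
  obtain ⟨l, hl⟩ := Function.ne_iff.1 h
  obtain ⟨i, hi⟩ := Function.ne_iff.1 hl
  filter_upwards [Filter.eventually_gt_atTop i] with j hj
  exact ⟨l, fun he => hi (Cantor.restrict_eq_restrict_iff.1 he i hj)⟩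

/-- A generator shape together with a cylinder for the parameters. -/
abbrev CylinderShape (k : ℕ) : Type := GenShape k × ℕ × (Fin (k + 1) → List Bool)

open scoped Classical in
/-- The indicator function of the generators of a given shape with parameters in a cylinder. -/
noncomputable def CylinderShape.indicator {k : ℕ} (i : CylinderShape k) : Gen k → ℚ
  | Gen.x m p ν =>
    if i.1 = Sum.inl (m, ν) ∧ ∀ l, (p l).restrict i.2.1 = i.2.2 l then 1 else 0
  | Gen.y η n => if i.1 = Sum.inr n ∧ ∀ l, (η l).restrict i.2.1 = i.2.2 l then 1 else 0

namespace ShelahGroup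

variable {k : ℕ}

/-- The homomorphism that agrees with `i.indicator` on all `x`'s and on the `y_{η, 0}`. -/
noncomputable def cylinderHom (i : CylinderShape k) : ShelahGroup k →+ ℚ :=
  (exists_hom i.indicator fun _ => 0).choose

theorem cylinderHom_x (i : CylinderShape k) (m : Fin (k + 1)) (p : {l // l ≠ m} → Cantor)
    (ν : List Bool) : cylinderHom i (of (Gen.x m p ν)) = i.indicator (Gen.x m p ν) :=
  (exists_hom i.indicator fun _ => 0).choose_spec.1 m p ν

theorem cylinderHom_y_zero (i : CylinderShape k) (η : Fin (k + 1) → Cantor) :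
    cylinderHom i (of (Gen.y η 0)) = i.indicator (Gen.y η 0) :=
  (exists_hom i.indicator fun _ => 0).choose_spec.2 η

theorem cylinderHom_x_congr (i : CylinderShape k) {N : ℕ} (hN : i.2.1 ≤ N) (m : Fin (k + 1))
    (ν : List Bool) (p q : {l // l ≠ m} → Cantor)
    (h : ∀ l, (p l).restrict N = (q l).restrict N) :
    cylinderHom i (of (Gen.x m p ν)) = cylinderHom i (of (Gen.x m q ν)) := by
  have h' : ∀ l, (p l).restrict i.2.1 = (q l).restrict i.2.1 := fun l =>
    Cantor.restrict_eq_restrict_iff.2 fun j hj =>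
      Cantor.restrict_eq_restrict_iff.1 (h l) j (hj.trans_le hN)
  simp only [cylinderHom_x, CylinderShape.indicator, h']

theorem cylinderHom_y_congr (i : CylinderShape k) {N : ℕ} (hN : i.2.1 ≤ N)
    (η ζ : Fin (k + 1) → Cantor) (h : ∀ l, (η l).restrict N = (ζ l).restrict N) (n : ℕ)
    (hn : n ≤ N) : cylinderHom i (of (Gen.y η n)) = cylinderHom i (of (Gen.y ζ n)) := by
  have h' : ∀ j ≤ N, ∀ l, (η l).restrict j = (ζ l).restrict j := fun j hj l =>
    Cantor.restrict_eq_restrict_iff.2 fun j' hj' =>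
      Cantor.restrict_eq_restrict_iff.1 (h l) j' (hj'.trans_le hj)
  induction n with
  | zero => simp only [cylinderHom_y_zero, CylinderShape.indicator, h' _ hN]
  | succ n ih =>
    have h1 := hom_equation (cylinderHom i) η n
    have h2 : ∀ m, cylinderHom i (of (Gen.x m (dropAt η m) ((η m).restrict n))) =
        cylinderHom i (of (Gen.x m (dropAt ζ m) ((ζ m).restrict n))) := fun m => by
      rw [h' n (by omega) m]
      exact cylinderHom_x_congr i hN m _ _ _ fun l => h l
    rw [ih (by omega), Finset.sum_congr rfl fun m _ => h2 m, ← hom_equation (cylinderHom i) ζ n] at h1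
    exact smul_right_injective ℚ n.factorial_ne_zero h1

theorem isLocallyConstant_cylinderHom_x (i : CylinderShape k) (m : Fin (k + 1)) (ν : List Bool) :
    IsLocallyConstant fun p : {l // l ≠ m} → Cantor => cylinderHom i (of (Gen.x m p ν)) :=
  isLocallyConstant_of_initial i.2.1 fun p q h => cylinderHom_x_congr i le_rfl m ν p q h

theorem isLocallyConstant_cylinderHom_y (i : CylinderShape k) (n : ℕ) :
    IsLocallyConstant fun η : Fin (k + 1) → Cantor => cylinderHom i (of (Gen.y η n)) :=
  isLocallyConstant_of_initial (max i.2.1 n) fun η ζ h =>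
    cylinderHom_y_congr i (le_max_left _ _) η ζ h n (le_max_right _ _)

theorem isLocallyConstant_cylinderHom_gen (i : CylinderShape k) (s : GenShape k) :
    IsLocallyConstant fun η : Fin (k + 1) → Cantor => cylinderHom i (of (s.gen η)) := by
  rcases s with ⟨m, ν⟩ | n
  · have hc : Continuous fun η : Fin (k + 1) → Cantor => dropAt η m := by
      unfold dropAt
      fun_prop
    exact (isLocallyConstant_cylinderHom_x i m ν).comp_continuous hc
  · exact isLocallyConstant_cylinderHom_y i n

theorem cylinderHom_y_eq_zero_iff (i : CylinderShape k) (hi : i.1 = Sum.inr 0)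
    (η : Fin (k + 1) → Cantor) (n : ℕ) : cylinderHom i (of (Gen.y η n)) = 0 ↔
      ∃ l, (η l).restrict i.2.1 ≠ i.2.2 l := by
  induction n with
  | zero => simp [cylinderHom_y_zero, CylinderShape.indicator, hi]
  | succ n ih =>
    have h1 := hom_equation (cylinderHom i) η n
    rw [Finset.sum_eq_zero fun m _ => by simp [cylinderHom_x, CylinderShape.indicator, hi],
      add_zero] at h1
    rw [← ih, ← h1, smul_eq_zero, or_iff_right n.factorial_ne_zero]

/-- The generators `x` together with the generators `y_{η, N}`. -/
def levelGens (k N : ℕ) : Set (Gen k) :=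
  {g | (∃ m p ν, g = Gen.x m p ν) ∨ ∃ η, g = Gen.y η N}

theorem exists_cylinderHom_separating (N : ℕ) (T : Set (Gen k)) (hT : T.Finite)
    (hTN : T ⊆ levelGens k N) (g : Gen k) (hg : g ∈ levelGens k N)
    (hgT : (∃ m p ν, g = Gen.x m p ν) → ∀ η, Gen.y η N ∉ T) :
    ∃ i : CylinderShape k, cylinderHom i (of g) ≠ 0 ∧
      ∀ g' ∈ T, g' ≠ g → cylinderHom i (of g') = 0 := by
  rcases hg with ⟨m, p, ν, rfl⟩ | ⟨η, rfl⟩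
  · have hev := (Filter.eventually_all_finite (l := Filter.atTop)
      (p := fun g' j => ∀ q, g' = Gen.x m q ν → q ≠ p →
        ∃ l, (q l).restrict j ≠ (p l).restrict j) hT).2 (by
      intro g' _
      by_cases h : ∃ q, g' = Gen.x m q ν ∧ q ≠ p
      · obtain ⟨q, rfl, hq⟩ := h
        filter_upwards [eventually_exists_restrict_ne hq] with j hj q' hq' _
        cases hq'
        exact hj
      · exact Filter.Eventually.of_forall fun j q hq hne => absurd ⟨q, hq, hne⟩ h)
    obtain ⟨j, hj⟩ := hev.exists
    obtain ⟨t, ht⟩ : ∃ t : Fin (k + 1) → List Bool, ∀ l : {l // l ≠ m}, t l = (p l).restrict j := by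
      classical
      exact ⟨fun l => if h : l ≠ m then (p ⟨l, h⟩).restrict j else [], fun l => by simp [l.2]⟩
    refine ⟨(Sum.inl (m, ν), j, t), by simp [cylinderHom_x, CylinderShape.indicator, ht], ?_⟩
    intro g' hg' hne
    rcases hTN hg' with ⟨m', q, ν', rfl⟩ | ⟨η, rfl⟩
    · rw [cylinderHom_x]
      refine if_neg ?_
      rintro ⟨h1, h2⟩
      simp only [Sum.inl.injEq, Prod.mk.injEq] at h1
      obtain ⟨rfl, rfl⟩ := h1
      obtain ⟨l, hl⟩ := hj _ hg' q rfl fun h => hne (by rw [h])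
      exact hl ((h2 l).trans (ht l))
    · exact absurd hg' (hgT ⟨m, p, ν, rfl⟩ η)
  · have hev := (Filter.eventually_all_finite (l := Filter.atTop)
      (p := fun g' j => ∀ ζ, g' = Gen.y ζ N → ζ ≠ η →
        ∃ l, (ζ l).restrict j ≠ (η l).restrict j) hT).2 (by
      intro g' _
      by_cases h : ∃ ζ, g' = Gen.y ζ N ∧ ζ ≠ η
      · obtain ⟨ζ, rfl, hζ⟩ := h
        filter_upwards [eventually_exists_restrict_ne hζ] with j hj ζ' hζ' _
        cases hζ'
        exact hj
      · exact Filter.Eventually.of_forall fun j ζ hζ hne => absurd ⟨ζ, hζ, hne⟩ h)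
    obtain ⟨j, hj⟩ := hev.exists
    refine ⟨(Sum.inr 0, j, fun l => (η l).restrict j), ?_, ?_⟩
    · rw [Ne, cylinderHom_y_eq_zero_iff _ rfl]
      simp
    · intro g' hg' hne
      rcases hTN hg' with ⟨m', q, ν', rfl⟩ | ⟨ζ, rfl⟩
      · simp [cylinderHom_x, CylinderShape.indicator]
      · rw [cylinderHom_y_eq_zero_iff _ rfl]
        exact hj _ hg' ζ rfl fun h => hne (by rw [h])

theorem closure_levelGens_mono : Monotone fun N : ℕ =>
    AddSubgroup.closure (of '' levelGens k N) := by
  refine monotone_nat_of_le_succ fun N => ?_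
  have hx : ∀ m p ν, of (Gen.x m p ν) ∈ AddSubgroup.closure (of '' levelGens k (N + 1)) :=
    fun m p ν => AddSubgroup.subset_closure ⟨_, Or.inl ⟨m, p, ν, rfl⟩, rfl⟩
  rw [AddSubgroup.closure_le]
  rintro _ ⟨_, ⟨m, p, ν, rfl⟩ | ⟨η, rfl⟩, rfl⟩
  · exact hx m p ν
  · have h1 := equation η N
    rw [SetLike.mem_coe, ← add_sub_cancel_right (of (Gen.y η N))
      (∑ m, of (Gen.x m (dropAt η m) ((η m).restrict N))), ← h1]
    have hy : of (Gen.y η (N + 1)) ∈ AddSubgroup.closure (of '' levelGens k (N + 1)) :=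
      AddSubgroup.subset_closure ⟨_, Or.inr ⟨η, rfl⟩, rfl⟩
    exact sub_mem (nsmul_mem hy _)
      (sum_mem fun m _ => hx _ _ _)

theorem exists_mem_closure_levelGens (a : ShelahGroup k) :
    ∃ N, a ∈ AddSubgroup.closure (of '' levelGens k N) := by
  have ha : a ∈ AddSubgroup.closure (Set.range (of (k := k))) := by
    rw [closure_range_of]; trivial
  induction ha using AddSubgroup.closure_induction with
  | mem a ha =>
    obtain ⟨g, rfl⟩ := ha
    cases g with
    | x m p ν => exact ⟨0, AddSubgroup.subset_closure ⟨_, Or.inl ⟨m, p, ν, rfl⟩, rfl⟩⟩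
    | y η n => exact ⟨n, AddSubgroup.subset_closure ⟨_, Or.inr ⟨η, rfl⟩, rfl⟩⟩
  | zero => exact ⟨0, zero_mem _⟩
  | add a b _ _ iha ihb =>
    obtain ⟨N, hN⟩ := iha
    obtain ⟨M, hM⟩ := ihb
    exact ⟨max N M, add_mem (closure_levelGens_mono (le_max_left N M) hN)
      (closure_levelGens_mono (le_max_right N M) hM)⟩
  | neg a _ iha => exact ⟨iha.choose, neg_mem iha.choose_spec⟩

theorem eq_zero_of_cylinderHom_eq_zero (a : ShelahGroup k)
    (ha : ∀ i : CylinderShape k, cylinderHom i a = 0) : a = 0 := by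
  obtain ⟨N, hN⟩ := exists_mem_closure_levelGens a
  have hspan : a ∈ Submodule.span ℤ (of '' levelGens k N) := by
    have : AddSubgroup.closure (of '' levelGens k N) ≤
        (Submodule.span ℤ (of '' levelGens k N)).toAddSubgroup :=
      (AddSubgroup.closure_le _).2 Submodule.subset_span
    exact this hN
  rw [Finsupp.mem_span_image_iff_linearCombination] at hspan
  obtain ⟨c, hc, rfl⟩ := hspan
  have hsub : (c.support : Set (Gen k)) ⊆ levelGens k N := (Finsupp.mem_supported ℤ c).1 hc
  have key : ∀ g ∈ levelGens k N,
      ((∃ m p ν, g = Gen.x m p ν) → ∀ η, Gen.y η N ∉ (c.support : Set (Gen k))) → c g = 0 := by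
    intro g hg hgT
    obtain ⟨i, hi, hi'⟩ := exists_cylinderHom_separating N _ c.support.finite_toSet hsub g hg hgT
    have h1 := ha i
    rw [Finsupp.linearCombination_apply, Finsupp.sum, map_sum, Finset.sum_eq_single g
      (fun g' hg' hne => by rw [map_zsmul, hi' g' hg' hne, smul_zero])
      (fun hg' => by rw [Finsupp.notMem_support_iff.1 hg', zero_smul, map_zero]),
      map_zsmul] at h1
    exact (smul_eq_zero.1 h1).resolve_right hi
  have hy : ∀ η, Gen.y η N ∉ (c.support : Set (Gen k)) := by
    intro η hη
    refine Finsupp.mem_support_iff.1 hη (key _ (Or.inr ⟨η, rfl⟩) ?_)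
    rintro ⟨m, p, ν, h⟩
    cases h
  have hc0 : c = 0 := by
    ext g
    by_contra hne
    exact hne (key g (hsub (Finsupp.mem_support_iff.2 hne)) fun _ => hy)
  rw [hc0, map_zero]

/-- The value of an integer combination of generators of given shapes, as a function of the
parameters of these generators. -/
def wordValue : List (ℤ × GenShape k) → (ℕ → Fin (k + 1) → Cantor) → ShelahGroup k
  | [], _ => 0
  | (z, s) :: w, p => z • of (s.gen (p 0)) + wordValue w fun i => p (i + 1)

theorem exists_wordValue_eq (a : ShelahGroup k) : ∃ w p, wordValue w p = a := by
  have ha : a ∈ AddSubgroup.closure (Set.range (of (k := k))) := by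
    rw [closure_range_of]; trivial
  have hcons : ∀ (z : ℤ) (g : Gen k) (a : ShelahGroup k), (∃ w p, wordValue w p = a) →
      ∃ w p, wordValue w p = z • of g + a := by
    rintro z g _ ⟨w, p, rfl⟩
    obtain ⟨s, η, rfl⟩ := GenShape.exists_gen_eq g
    let q : ℕ → Fin (k + 1) → Cantor := fun i => Nat.casesOn i η p
    have h0 : q 0 = η := rfl
    have h1 : (fun i => q (i + 1)) = p := rfl
    exact ⟨(z, s) :: w, q, by rw [wordValue, h0, h1]⟩
  induction ha using AddSubgroup.closure_induction_left with
  | zero => exact ⟨[], fun _ _ _ => false, by rw [wordValue]⟩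
  | add_left x hx y _ ih =>
    obtain ⟨g, rfl⟩ := hx
    simpa using hcons 1 g y ih
  | neg_add_cancel x hx y _ ih =>
    obtain ⟨g, rfl⟩ := hx
    simpa using hcons (-1) g y ih

theorem isLocallyConstant_cylinderHom_wordValue (i : CylinderShape k)
    (w : List (ℤ × GenShape k)) :
    IsLocallyConstant fun p : ℕ → Fin (k + 1) → Cantor => cylinderHom i (wordValue w p) := by
  induction w with
  | nil =>
    simp only [wordValue]
    exact IsLocallyConstant.const _
  | cons q w ih =>
    have h1 := ((isLocallyConstant_cylinderHom_gen i q.2).comp (fun r => q.1 • r)).comp_continuous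
      (f := fun (p : ℕ → Fin (k + 1) → Cantor) => p 0) (by fun_prop)
    have h2 := ih.comp_continuous (f := fun (p : ℕ → Fin (k + 1) → Cantor) i => p (i + 1))
      (by fun_prop)
    convert h1.add h2 using 2 with p
    simp [wordValue]

theorem exists_coding (k : ℕ) : ∃ c : ShelahGroup k → ℕ → ℕ, IsCodingIn IsFSigmaSet c ∧
    HasContinuousGenerators c := by
  obtain ⟨e, he⟩ := exists_surjective_nat (CylinderShape k)
  let c (a : ShelahGroup k) (n : ℕ) : ℕ := Encodable.encode (cylinderHom (e n) a)
  have hcont : ∀ {P : Type} [TopologicalSpace P] (v : P → ShelahGroup k),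
      (∀ i, IsLocallyConstant fun p => cylinderHom i (v p)) → Continuous fun p => c (v p) :=
    fun v hv => continuous_pi fun n => ((hv (e n)).comp Encodable.encode).continuous
  have hinj : Function.Injective c := by
    intro a b hab
    rw [← sub_eq_zero]
    refine eq_zero_of_cylinderHom_eq_zero _ fun i => ?_
    obtain ⟨n, rfl⟩ := he i
    rw [map_sub, Encodable.encode_injective (congrFun hab n), sub_self]
  have hw := isLocallyConstant_cylinderHom_wordValue (k := k)
  refine ⟨c, ⟨hinj, ?_, ?_, ?_⟩, fun m ν => hcont _ fun i => isLocallyConstant_cylinderHom_x i m ν,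
    fun n => hcont _ fun i => isLocallyConstant_cylinderHom_y i n⟩
  · convert isFSigmaSet_iUnion_range (g := fun (w : List (ℤ × GenShape k)) p => c (wordValue w p))
      fun w => hcont _ fun i => hw i w using 1
    ext x
    simp only [Set.mem_range, Set.mem_iUnion]
    constructor
    · rintro ⟨a, rfl⟩
      obtain ⟨w, p, rfl⟩ := exists_wordValue_eq a
      exact ⟨w, p, rfl⟩
    · rintro ⟨w, p, rfl⟩
      exact ⟨_, rfl⟩
  · have h1 : ∀ w : List (ℤ × GenShape k) × List (ℤ × GenShape k), Continuous fun
        p : (ℕ → Fin (k + 1) → Cantor) × (ℕ → Fin (k + 1) → Cantor) =>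
        (c (wordValue w.1 p.1), c (wordValue w.2 p.2),
          c (wordValue w.1 p.1 + wordValue w.2 p.2)) := fun w => by
      have hf := fun i => (hw i w.1).comp_continuous
        (continuous_fst (X := ℕ → Fin (k + 1) → Cantor) (Y := ℕ → Fin (k + 1) → Cantor))
      have hs := fun i => (hw i w.2).comp_continuous
        (continuous_snd (X := ℕ → Fin (k + 1) → Cantor) (Y := ℕ → Fin (k + 1) → Cantor))
      refine (hcont _ hf).prodMk ((hcont _ hs).prodMk (hcont _ fun i => ?_))
      simp only [map_add]
      exact (hf i).add (hs i)
    convert isFSigmaSet_iUnion_range h1 using 1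
    ext x
    simp only [Set.mem_ofPred_eq, Set.mem_range, Set.mem_iUnion]
    constructor
    · rintro ⟨a, b, rfl⟩
      obtain ⟨w, p, rfl⟩ := exists_wordValue_eq a
      obtain ⟨w', p', rfl⟩ := exists_wordValue_eq b
      exact ⟨(w, w'), (p, p'), rfl⟩
    · rintro ⟨w, p, rfl⟩
      exact ⟨_, _, rfl⟩
  · have h1 : ∀ w : List (ℤ × GenShape k), Continuous fun p : ℕ → Fin (k + 1) → Cantor =>
        (c (wordValue w p), c (-wordValue w p)) := fun w => by
      refine (hcont _ fun i => hw i w).prodMk (hcont _ fun i => ?_)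
      simp only [map_neg]
      exact (hw i w).neg
    convert isFSigmaSet_iUnion_range h1 using 1
    ext x
    simp only [Set.mem_ofPred_eq, Set.mem_range, Set.mem_iUnion]
    constructor
    · rintro ⟨a, rfl⟩
      obtain ⟨w, p, rfl⟩ := exists_wordValue_eq a
      exact ⟨w, p, rfl⟩
    · rintro ⟨w, p, rfl⟩
      exact ⟨_, rfl⟩

end ShelahGroup

theorem mk_cantor : #Cantor = (2 : Cardinal.{0}) ^ aleph0.{0} := by
  simp [Cantor]

theorem lt_aleph_natCast_succ {κ : Cardinal.{0}} {k : ℕ} :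
    κ < aleph ((k + 1 : ℕ) : Ordinal.{0}) ↔ κ ≤ aleph ((k : ℕ) : Ordinal.{0}) := by
  rw [Nat.cast_succ, ← succ_aleph, Order.lt_succ_iff]

namespace ShelahGroup

variable {k : ℕ}

theorem isCardFree (k : ℕ) :
    IsCardFree (aleph ((k + 1 : ℕ) : Ordinal.{0})) (ShelahGroup k) := by
  intro H hH
  obtain ⟨S, hS, hle⟩ := exists_parametrized_ge (aleph0_le_aleph _) H (lt_aleph_natCast_succ.1 hH)
  exact free_of_le_parametrized hS H hle

theorem not_isCardFree
    (h : aleph ((k + 1 : ℕ) : Ordinal.{0}) ≤ (2 : Cardinal.{0}) ^ aleph0.{0}) :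
    ¬ IsCardFree (aleph ((k + 2 : ℕ) : Ordinal.{0})) (ShelahGroup k) := by
  intro hfree
  rw [← mk_cantor] at h
  obtain ⟨U, hU⟩ := Cardinal.le_mk_iff_exists_set.1 h
  have := hfree (parametrized k U)
    (lt_aleph_natCast_succ.2 (mk_parametrized_le (aleph0_le_aleph _) hU.le))
  exact (lt_aleph_natCast_succ.2 (mk_le_of_free (k := k) (U := U) le_rfl)).ne hU

theorem free_iff : Module.Free ℤ (ShelahGroup k) ↔
    (2 : Cardinal.{0}) ^ aleph0.{0} ≤ aleph ((k : ℕ) : Ordinal.{0}) := by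
  rw [← mk_cantor, ← mk_univ]
  constructor
  · intro h
    have : Module.Free ℤ (⊤ : AddSubgroup (ShelahGroup k)) :=
      Module.Free.of_equiv AddSubgroup.topEquiv.symm.toIntLinearEquiv
    exact mk_le_of_free (H := ⊤) le_top
  · intro h
    have := free_of_le_parametrized h (⊤ : AddSubgroup (ShelahGroup k)) parametrized_univ.ge
    exact Module.Free.of_equiv
      (AddSubgroup.topEquiv (G := ShelahGroup k)).toIntLinearEquiv

end ShelahGroup

theorem mainTheorem3 (k : ℕ) :
    (∃ c : ShelahGroup k → ℕ → ℕ,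
      IsCodingIn IsFSigmaSet c ∧ IsCodingIn IsBorelSet c ∧ HasContinuousGenerators c) ∧
    IsCardFree (aleph ((k + 1 : ℕ) : Ordinal.{0})) (ShelahGroup k) ∧
    (aleph ((k + 1 : ℕ) : Ordinal.{0}) ≤ (2 : Cardinal.{0}) ^ aleph0.{0} →
      ¬ Module.Free ℤ (ShelahGroup k) ∧
      ¬ IsCardFree (aleph ((k + 2 : ℕ) : Ordinal.{0})) (ShelahGroup k)) ∧
    (Module.Free ℤ (ShelahGroup k) ↔
      (2 : Cardinal.{0}) ^ aleph0.{0} ≤ aleph ((k : ℕ) : Ordinal.{0})) := by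
  obtain ⟨c, hc, hg⟩ := ShelahGroup.exists_coding k
  refine ⟨⟨c, hc, hc.mono fun X _ s h => h.isBorelSet, hg⟩, ShelahGroup.isCardFree k,
    fun h => ⟨fun hfree => ?_, ShelahGroup.not_isCardFree h⟩, ShelahGroup.free_iff⟩
  exact (lt_aleph_natCast_succ.2 (ShelahGroup.free_iff.1 hfree)).not_ge h
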